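/- Let $H$ be a complex Hilbert space and let $\mathbb D$ be the open unit disc in $\mathbb C$. A bounded linear operator $T$ on $H$ belongs to the Cowen--Douglas class $B_1(\mathbb D)$ if for every $w\in\mathbb D$ the range of $T-w$ is closed and $\dim\ker(T-w)=1$, and if the linear span of $\bigcup_{w\in\mathbb D}\ker(T-w)$ is dense in $H$. The operator $T$ is homogeneous if its spectrum is contained in the closed unit disc and for every bi-holomorphic automorphism $\varphi(z)=e^{i\theta}\frac{z-\alpha}{1-\bar\alpha z}$ of $\mathbb D$ ($\theta\in\mathbb R$, $\alpha\in\mathbb D$) there is a unitary operator $U_\varphi$ on $H$ with $U_\varphi^*TU_\varphi=\varphi(T)$, where $\varphi(T)=e^{i\theta}(T-\alpha)(1-\bar\alpha T)^{-1}$. Theorem. If $T$ is a homogeneous operator in $B_1(\mathbb D)$, then there is a real number $\lambda>0$ such that multiplication by the coordinate function, $(Mf)(z)=zf(z)$, defines a bounded operator $M$ on the Hilbert space $\mathcal H^{(\lambda)}$ of functions on $\mathbb D$ with reproducing kernel $$K^{(\lambda)}(z,w)=(1-z\bar w)^{-2\lambda},\qquad z,w\in\mathbb D$$ (principal branch of the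 power), and $T$ is unitarily equivalent to the adjoint $M^*$. -/

import Mathlib

open scoped Complex.UnitDisc ComplexConjugate InnerProductSpace

noncomputable section

/-! ### The Cowen-Douglas class of rank one -/

/-- A bounded operator `T` on a Hilbert space `H` belongs to the Cowen-Douglas class `B₁(Ω)`:
for every `w ∈ Ω` the range of `T - w` is closed and its kernel has dimension one, and the span of
the eigenspaces `ker (T - w)`, `w ∈ Ω`, is dense. -/
structure IsCowenDouglasOne {H : Type*} [NormedAddCommGroup H] [InnerProductSpace ℂ H]
    (Ω : Set ℂ) (T : H →L[ℂ] H) : Prop where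
  isClosed_range : ∀ w ∈ Ω, IsClosed (Set.range (T - w • (1 : H →L[ℂ] H)))
  dense_span : Dense
    ((⨆ w ∈ Ω, LinearMap.ker (T - w • (1 : H →L[ℂ] H)).toLinearMap : Submodule ℂ H) : Set H)
  finrank_ker : ∀ w ∈ Ω,
    Module.finrank ℂ (LinearMap.ker (T - w • (1 : H →L[ℂ] H)).toLinearMap) = 1

/-! ### Homogeneous operators -/

/-- `φ` restricts to a bi-holomorphic automorphism of the open unit disc. -/
def IsDiscAutomorphism (φ : ℂ → ℂ) : Prop :=
  DifferentiableOn ℂ φ (Metric.ball 0 1) ∧ Set.MapsTo φ (Metric.ball 0 1) (Metric.ball 0 1) ∧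
  ∃ ψ : ℂ → ℂ, DifferentiableOn ℂ ψ (Metric.ball 0 1) ∧
    Set.MapsTo ψ (Metric.ball 0 1) (Metric.ball 0 1) ∧
    Set.InvOn ψ φ (Metric.ball 0 1) (Metric.ball 0 1)

/-- The Möbius map `z ↦ e^{iθ} (z - α) / (1 - ᾱ z)`. -/
def moebius (θ : ℝ) (α z : ℂ) : ℂ :=
  Complex.exp (θ * Complex.I) * ((z - α) / (1 - conj α * z))

/-- The operator `e^{iθ} (T - α) (1 - ᾱ T)⁻¹`. It is only used when `‖α‖ < 1` and the spectrum of
`T` lies in the closed unit disc, so that `1 - ᾱ T` is invertible. -/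
def moebiusOperator {H : Type*} [NormedAddCommGroup H] [InnerProductSpace ℂ H]
    (θ : ℝ) (α : ℂ) (T : H →L[ℂ] H) : H →L[ℂ] H :=
  Complex.exp (θ * Complex.I) •
    ((T - α • (1 : H →L[ℂ] H)) * Ring.inverse (1 - conj α • T))

/-- A bounded operator `T` is homogeneous: its spectrum lies in the closed unit disc, and for every
bi-holomorphic automorphism `φ(z) = e^{iθ} (z - α) / (1 - ᾱ z)` of the open unit disc there is a
unitary operator `U` with `U* T U = φ(T)`. -/
def IsHomogeneousOperator {H : Type*} [NormedAddCommGroup H] [InnerProductSpace ℂ H]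
    [CompleteSpace H] (T : H →L[ℂ] H) : Prop :=
  spectrum ℂ T ⊆ Metric.closedBall 0 1 ∧
  ∀ φ : ℂ → ℂ, IsDiscAutomorphism φ → ∀ (θ : ℝ) (α : ℂ), ‖α‖ < 1 →
    Set.EqOn φ (moebius θ α) (Metric.ball 0 1) →
    ∃ U ∈ unitary (H →L[ℂ] H), star U * T * U = moebiusOperator θ α T

/-! ### The reproducing kernel Hilbert spaces with kernel `(1 - z w̄)^{-2l}` -/

/-- The kernel `K^{(l)}(z, w) = (1 - z w̄)^{-2l}` on the open unit disc (principal branch of the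
power; `1 - z w̄` has positive real part), a complex number being identified with the
multiplication operator on `ℂ` that it defines. -/
def discKernel (l : ℝ) : Matrix 𝔻 𝔻 (ℂ →L[ℂ] ℂ) :=
  Matrix.of fun z w => ((1 - (z : ℂ) * conj (w : ℂ)) ^ (-(2 * l) : ℂ)) • (1 : ℂ →L[ℂ] ℂ)

theorem discKernel_apply (l : ℝ) (z w : 𝔻) (c : ℂ) :
    discKernel l z w c = (1 - (z : ℂ) * conj (w : ℂ)) ^ (-(2 * l) : ℂ) * c := by
  simp [discKernel]

/-- The binomial expansion of the kernel, with nonnegative coefficients. -/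
theorem hasSum_discKernel {l : ℝ} (hl : 0 < l) :
    ∃ a : ℕ → ℝ, (∀ n, 0 ≤ a n) ∧ ∀ x : ℂ, ‖x‖ < 1 →
      HasSum (fun n => (a n : ℂ) * x ^ n) ((1 - x) ^ (-(2 * l) : ℂ)) := by
  refine ⟨fun n => Ring.choose (2 * l + n - 1) n, fun n => ?_, fun x hx => ?_⟩
  · change 0 ≤ Ring.choose (2 * l + n - 1) n
    rw [← Ring.multichoose_eq]
    have h := Ring.factorial_nsmul_multichoose_eq_ascPochhammer (2 * l) n
    rw [Polynomial.ascPochhammer_smeval_eq_eval, nsmul_eq_mul] at h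
    have h1 := ascPochhammer_pos n (2 * l) (by positivity)
    rw [← h] at h1
    exact (pos_of_mul_pos_right h1 (by positivity)).le
  · have h := (Complex.one_div_one_sub_cpow_hasFPowerSeriesOnBall_zero (2 * l)).hasSum (y := x)
      (by simpa [enorm_eq_nnnorm, ← NNReal.coe_lt_coe] using hx)
    simp only [FormalMultilinearSeries.ofScalars_apply_eq, zero_add, smul_eq_mul] at h
    rw [Complex.cpow_neg, ← one_div]
    have e : ∀ n : ℕ, ((Ring.choose (2 * l + n - 1) n : ℝ) : ℂ) =
        Ring.choose (2 * (l : ℂ) + n - 1) n := fun n => by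
      rw [Complex.ofReal_choose]
      push_cast
      rfl
    simp only [e]
    exact h

theorem conj_one_sub_cpow {l : ℝ} (hl : 0 < l) {x : ℂ} (hx : ‖x‖ < 1) :
    conj ((1 - x) ^ (-(2 * l) : ℂ)) = (1 - conj x) ^ (-(2 * l) : ℂ) := by
  obtain ⟨a, -, ha⟩ := hasSum_discKernel hl
  have h1 := (ha x hx).map (starRingEnd ℂ) Complex.continuous_conj
  have h2 := ha (conj x) (by simpa using hx)
  refine HasSum.unique h1 ?_
  convert h2 using 2 with n
  simp [Function.comp]

theorem norm_coe_mul_conj_lt_one (z w : 𝔻) : ‖(z : ℂ) * conj (w : ℂ)‖ < 1 := by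
  rw [norm_mul, RCLike.norm_conj]
  exact mul_lt_one_of_nonneg_of_lt_one_left (norm_nonneg _) z.norm_lt_one w.norm_lt_one.le

theorem conj_kernel {l : ℝ} (hl : 0 < l) (z w : 𝔻) :
    conj ((1 - (z : ℂ) * conj (w : ℂ)) ^ (-(2 * l) : ℂ)) =
      (1 - (w : ℂ) * conj (z : ℂ)) ^ (-(2 * l) : ℂ) := by
  rw [conj_one_sub_cpow hl (norm_coe_mul_conj_lt_one z w), map_mul, Complex.conj_conj,
    mul_comm (conj (z : ℂ))]

open scoped ComplexOrder in
theorem posSemidef_discKernel {l : ℝ} (hl : 0 < l) : (discKernel l).PosSemidef := by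
  refine ((RKHS.posSemidef_tfae (K := discKernel l)).out 0 2 rfl rfl).mpr ⟨?_, fun v => ?_⟩
  · ext z w
    refine ext_inner_right ℂ fun c => ?_
    rw [Matrix.conjTranspose_apply, ContinuousLinearMap.star_eq_adjoint,
      ContinuousLinearMap.adjoint_inner_left, discKernel_apply, discKernel_apply]
    simp only [RCLike.inner_apply, map_mul, conj_kernel hl]
    ring
  · obtain ⟨a, ha0, ha⟩ := hasSum_discKernel hl
    have key : HasSum (fun n => (a n : ℂ) *
          (conj (∑ x ∈ v.support, conj (x : ℂ) ^ n * v x) *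
            ∑ x ∈ v.support, conj (x : ℂ) ^ n * v x))
        (v.sum fun x w => v.sum fun x' w' => ⟪discKernel l x' x w, w'⟫_ℂ) := by
      have h : ∀ x ∈ v.support, ∀ x' ∈ v.support,
          HasSum (fun n => (a n : ℂ) * ((x : ℂ) * conj (x' : ℂ)) ^ n * (conj (v x) * v x'))
            ⟪discKernel l x' x (v x), v x'⟫_ℂ := by
        intro x _ x' _
        have e : ⟪discKernel l x' x (v x), v x'⟫_ℂ =
            (1 - (x : ℂ) * conj (x' : ℂ)) ^ (-(2 * l) : ℂ) * (conj (v x) * v x') := by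
          rw [discKernel_apply]
          simp only [RCLike.inner_apply, map_mul, conj_kernel hl]
          ring
        rw [e]
        exact (ha _ (norm_coe_mul_conj_lt_one x x')).mul_right _
      have h2 := hasSum_sum fun x hx => hasSum_sum (h x hx)
      refine (congrArg (HasSum · _) (funext fun n => ?_)).mpr h2
      rw [map_sum, Finset.sum_mul_sum, Finset.mul_sum]
      refine Finset.sum_congr rfl fun x _ => ?_
      rw [Finset.mul_sum]
      refine Finset.sum_congr rfl fun x' _ => ?_
      simp [mul_pow]
      ring
    have hre := (Complex.hasSum_iff _ _).mp key |>.1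
    refine hre.nonneg fun n => ?_
    rw [← Complex.normSq_eq_conj_mul_self, ← Complex.ofReal_mul, Complex.ofReal_re]
    exact mul_nonneg (ha0 n) (Complex.normSq_nonneg _)

instance fact_posSemidef_discKernel (l : Set.Ioi (0 : ℝ)) : Fact (discKernel l).PosSemidef :=
  ⟨posSemidef_discKernel l.2⟩

/-- The Hilbert space `H^{(l)}` of functions on the open unit disc with reproducing kernel
`K^{(l)}(z, w) = (1 - z w̄)^{-2l}`, for `l > 0`. -/
abbrev DiscRKHS (l : Set.Ioi (0 : ℝ)) : Type := RKHS.OfKernel (discKernel l)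

/-- The bounded operator `M` on `H^{(l)}` is multiplication by the coordinate function `z`. -/
def IsMultiplicationByZ {l : Set.Ioi (0 : ℝ)} (M : DiscRKHS l →L[ℂ] DiscRKHS l) : Prop :=
  ∀ (f : DiscRKHS l) (z : 𝔻), (M f) z = (z : ℂ) * f z

/-- Two bounded operators on Hilbert spaces are unitarily equivalent. -/
def UnitarilyEquivalent {H₁ H₂ : Type*} [NormedAddCommGroup H₁] [InnerProductSpace ℂ H₁]
    [NormedAddCommGroup H₂] [InnerProductSpace ℂ H₂]
    (T₁ : H₁ →L[ℂ] H₁) (T₂ : H₂ →L[ℂ] H₂) : Prop :=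
  ∃ V : H₁ ≃ₗᵢ[ℂ] H₂, ∀ x, V (T₁ x) = T₂ (V x)

end

/-!
The idea is that a homogeneous operator of the class `B₁(𝔻)` is, by its rotational symmetry alone, a
backward weighted shift, and that the remaining Möbius symmetries determine its weights.

The eigenvectors at points near `0` approach the kernel of `T`, so the closed range of `T` contains
all eigenvectors, and `T` is onto (`IsCowenDouglasOne.surjective`). Let `S` be the right inverse of
`T` with values orthogonal to `ker T`, let `e` be a unit vector in `ker T`, and put `v n = S ^ n e`.
The unitaries implementing rotations act on `v n` by a constant times the `n`-th power of the
rotation, so the `v n` are orthogonal (`IsHomogeneousOperator.exists_isBackwardShiftOn`). The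
vectors `γ w = ∑ wⁿ v n` span the eigenspaces wherever the series converges, and
`⟪γ w, γ z⟫ = f (w̄ z)` with `f x = ∑ ‖v n‖² xⁿ`.

A unitary implementing `s ↦ u = (s + t) / (1 + s t)`, with `s`, `t` real, takes the eigenlines at
`0` and `s` to those at `t` and `u`. Comparing angles gives `f (t u)² f (s²) = f (t²) f (u²)`
(`IsHomogeneousOperator.inner_sq_eq`). The derivative at `t = 0` of this identity is the equation
`f' (x) (1 - x) = ‖v 1‖² f x` at `x = s²`, whose solution is `f x = (1 - x) ^ (-‖v 1‖²)`
(`eq_one_sub_rpow_of_moebius_invariant`). With `2 l = ‖v 1‖²`, the norms `‖v n‖²` are therefore the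
coefficients of the kernel of `H^{(l)}`. In particular `γ w` exists on the whole disc, and
`γ z̄ ↦ K(·, z)` preserves inner products. As both families span dense subspaces, this map extends
to a unitary, which carries `T` to the adjoint of multiplication by `z`.
-/

/-! ### Power series of one real variable -/

section PowerSeries

open Filter Topology

theorem hasFPowerSeriesOnBall_ofScalars_of_hasSum {a : ℕ → ℝ} {f : ℝ → ℝ} {ρ : ℝ} (hρ : 0 < ρ)
    (h : ∀ x, |x| < ρ → HasSum (fun n => a n * x ^ n) (f x)) :
    HasFPowerSeriesOnBall f (FormalMultilinearSeries.ofScalars ℝ a) 0 (ENNReal.ofReal ρ) where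
  r_le := by
    refine ENNReal.le_of_forall_nnreal_lt fun r hr => ?_
    refine FormalMultilinearSeries.le_radius_of_tendsto (l := 0) _ ?_
    have hr' : |(r : ℝ)| < ρ := by
      rw [abs_of_nonneg (NNReal.coe_nonneg r)]
      have := (ENNReal.toReal_lt_toReal (by simp) (by simp)).mpr hr
      simpa [hρ.le] using this
    have h0 := (h r hr').summable.tendsto_atTop_zero.norm
    simpa [FormalMultilinearSeries.ofScalars_norm] using h0
  r_pos := by simpa using hρ
  hasSum := fun {y} hy => by
    have hy' : |y| < ρ := by
      rw [Metric.mem_eball, edist_dist, ENNReal.ofReal_lt_ofReal_iff hρ] at hy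
      simpa using hy
    simpa [FormalMultilinearSeries.ofScalars_apply_eq, mul_comm] using h y hy'

theorem eq_of_hasSum_of_eqOn {a b : ℕ → ℝ} {f g : ℝ → ℝ} {ρ : ℝ} (hρ : 0 < ρ)
    (hf : ∀ x, |x| < ρ → HasSum (fun n => a n * x ^ n) (f x))
    (hg : ∀ x, |x| < ρ → HasSum (fun n => b n * x ^ n) (g x))
    (hfg : Set.EqOn f g (Set.Ioo 0 ρ)) : a = b := by
  have pf := (hasFPowerSeriesOnBall_ofScalars_of_hasSum hρ hf).hasFPowerSeriesAt
  have pg := (hasFPowerSeriesOnBall_ofScalars_of_hasSum hρ hg).hasFPowerSeriesAt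
  have hfr : ∃ᶠ x in 𝓝[≠] (0 : ℝ), f x = g x := by
    have h1 : ∀ᶠ x in 𝓝[>] (0 : ℝ), f x = g x :=
      Filter.eventually_of_mem (Ioo_mem_nhdsGT hρ) hfg
    exact h1.frequently.filter_mono (nhdsWithin_mono _ fun x hx => ne_of_gt hx)
  exact FormalMultilinearSeries.ofScalars_series_injective ℝ ℝ
    (pf.eq_formalMultilinearSeries_of_eventually pg
      ((pf.analyticAt.frequently_eq_iff_eventually_eq pg.analyticAt).mp hfr))

/-- Solutions of `(1 - x) f' = c f` with `f 0 = 1` are binomial. -/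
theorem eq_one_sub_rpow_of_deriv {f f' : ℝ → ℝ} {c ρ : ℝ} (hρ1 : ρ ≤ 1) (h0 : f 0 = 1)
    (hf : ∀ x ∈ Set.Ico 0 ρ, HasDerivAt f (f' x) x)
    (hode : ∀ x ∈ Set.Ico 0 ρ, f' x * (1 - x) = c * f x) :
    ∀ x ∈ Set.Ico 0 ρ, f x = (1 - x) ^ (-c) := by
  intro x hx
  have hd : ∀ y ∈ Set.Ico 0 ρ, HasDerivAt (fun y => f y * (1 - y) ^ c) 0 y := by
    intro y hy
    have hy1 : 0 < 1 - y := by linarith [hy.2]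
    have h1 : HasDerivAt (fun y : ℝ => 1 - y) (-1) y := by
      simpa using (hasDerivAt_id y).const_sub 1
    have h2 := (hf y hy).mul (h1.rpow_const (p := c) (Or.inl hy1.ne'))
    refine h2.congr_deriv ?_
    rw [Real.rpow_sub_one hy1.ne']
    have := hode y hy
    field_simp
    linear_combination (1 - y) ^ c * this
  have hc := constant_of_has_deriv_right_zero (f := fun y => f y * (1 - y) ^ c) (a := 0) (b := x)
    (fun y hy => (hd y ⟨hy.1, hy.2.trans_lt hx.2⟩).continuousAt.continuousWithinAt)
    (fun y hy => (hd y ⟨hy.1, hy.2.trans hx.2⟩).hasDerivWithinAt) x ⟨hx.1, le_rfl⟩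
  have hx1 : 0 < 1 - x := by linarith [hx.2]
  simp only [h0, sub_zero, Real.one_rpow, mul_one] at hc
  rw [Real.rpow_neg hx1.le]
  exact eq_inv_of_mul_eq_one_left hc

/-- Invariance of the angle function of a power series under the real Moebius maps
`s ↦ (s + t) / (1 + s t)`, differentiated at `t = 0`, is the differential equation of the binomial
series. -/
theorem eq_one_sub_rpow_of_moebius_invariant {a : ℕ → ℝ} {f : ℝ → ℝ} {r : ℝ} (hr : 0 < r)
    (hr1 : r ≤ 1) (ha : a 0 = 1)
    (hf : ∀ x, |x| < r ^ 2 → HasSum (fun n => a n * x ^ n) (f x))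
    (hinv : ∀ s t, |s| < r → |t| < r → |(s + t) / (1 + s * t)| < r →
      f (t * ((s + t) / (1 + s * t))) ^ 2 * f (s ^ 2) =
        f (t ^ 2) * f (((s + t) / (1 + s * t)) ^ 2)) :
    ∀ x ∈ Set.Ico 0 (r ^ 2), f x = (1 - x) ^ (-a 1) := by
  have pf := hasFPowerSeriesOnBall_ofScalars_of_hasSum (pow_pos hr 2) hf
  have hdiff : ∀ x, |x| < r ^ 2 → HasDerivAt f (deriv f x) x := fun x hx => by
    refine (pf.analyticAt_of_mem ?_).differentiableAt.hasDerivAt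
    rw [Metric.mem_eball, edist_dist, ENNReal.ofReal_lt_ofReal_iff (pow_pos hr 2)]
    simpa using hx
  have hf0 : f 0 = 1 := by
    have h := hf 0 (by simpa using pow_pos hr 2)
    refine h.unique ?_
    convert hasSum_single (f := fun n => a n * (0 : ℝ) ^ n) 0 fun n hn => by simp [hn]
    simp [ha]
  have hf1 : HasDerivAt f (a 1) 0 := by
    have h := pf.hasFPowerSeriesAt.hasDerivAt
    simpa [FormalMultilinearSeries.ofScalars_apply_eq] using h
  refine eq_one_sub_rpow_of_deriv (f' := deriv f) (by nlinarith) hf0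
    (fun x hx => hdiff x (by rw [abs_of_nonneg hx.1]; exact hx.2)) fun x hx => ?_
  rcases hx.1.eq_or_lt with rfl | hx0
  · simp [hf1.deriv, hf0]
  obtain ⟨s, hs0, rfl⟩ : ∃ s, 0 < s ∧ s ^ 2 = x :=
    ⟨√x, Real.sqrt_pos.mpr hx0, Real.sq_sqrt hx.1⟩
  have hsr : s < r := lt_of_pow_lt_pow_left₀ 2 hr.le hx.2
  have hφ : HasDerivAt (fun t : ℝ => (s + t) / (1 + s * t)) (1 - s ^ 2) 0 := by
    have h1 : HasDerivAt (fun t : ℝ => s + t) 1 0 := (hasDerivAt_id (0 : ℝ)).const_add s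
    have h2 : HasDerivAt (fun t : ℝ => 1 + s * t) s 0 := by
      simpa using ((hasDerivAt_id (0 : ℝ)).const_mul s).const_add 1
    refine (h1.div h2 (by simp)).congr_deriv ?_
    simp
    ring
  have hev : ∀ᶠ t in 𝓝 (0 : ℝ), f (t * ((s + t) / (1 + s * t))) ^ 2 * f (s ^ 2) =
      f (t ^ 2) * f (((s + t) / (1 + s * t)) ^ 2) := by
    have h1 : ∀ᶠ t in 𝓝 (0 : ℝ), |t| < r :=
      continuous_abs.continuousAt.eventually_lt continuousAt_const (by simpa using hr)
    have h2 : ∀ᶠ t in 𝓝 (0 : ℝ), |(s + t) / (1 + s * t)| < r :=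
      hφ.continuousAt.abs.eventually_lt continuousAt_const
        (by simpa [abs_of_pos hs0] using hsr)
    filter_upwards [h1, h2] with t ht1 ht2
    exact hinv s t (by rwa [abs_of_pos hs0]) ht1 ht2
  have hL : HasDerivAt (fun t => f (t * ((s + t) / (1 + s * t))) ^ 2 * f (s ^ 2))
      (2 * (a 1 * s) * f (s ^ 2)) 0 := by
    have h1 := (hasDerivAt_id (0 : ℝ)).mul hφ
    have h2 := (((hf1.comp_of_eq 0 h1 (by simp)).pow 2).mul_const (f (s ^ 2)))
    refine h2.congr_deriv ?_
    simp [hf0]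
  have hR : HasDerivAt (fun t => f (t ^ 2) * f (((s + t) / (1 + s * t)) ^ 2))
      (deriv f (s ^ 2) * (2 * s * (1 - s ^ 2))) 0 := by
    have h1 := hf1.comp_of_eq 0 (hasDerivAt_pow 2 (0 : ℝ)) (by simp)
    have h2 := (hdiff (s ^ 2) (by rw [abs_of_nonneg hx.1]; exact hx.2)).comp_of_eq 0 (hφ.pow 2)
      (by simp)
    refine (h1.mul h2).congr_deriv ?_
    simp [hf0]
  have heq := (hL.congr_of_eventuallyEq (EventuallyEq.symm hev)).unique hR
  have h2s : 2 * s ≠ 0 := by positivity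
  refine mul_left_cancel₀ h2s ?_
  linear_combination -heq

end PowerSeries

/-! ### Möbius maps and homogeneous operators -/

theorem one_sub_conj_mul_ne_zero {α z : ℂ} (hα : ‖α‖ < 1) (hz : ‖z‖ < 1) :
    1 - conj α * z ≠ 0 := by
  intro h
  have h1 : ‖conj α * z‖ < 1 := by
    rw [norm_mul, RCLike.norm_conj]
    exact mul_lt_one_of_nonneg_of_lt_one_left (norm_nonneg _) hα hz.le
  rw [← sub_eq_zero.mp h] at h1
  simp at h1

theorem norm_moebius_lt_one {θ : ℝ} {α z : ℂ} (hα : ‖α‖ < 1) (hz : ‖z‖ < 1) :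
    ‖moebius θ α z‖ < 1 := by
  rw [moebius, norm_mul, Complex.norm_exp_ofReal_mul_I, one_mul, norm_div,
    div_lt_one (norm_pos_iff.mpr (one_sub_conj_mul_ne_zero hα hz))]
  refine lt_of_pow_lt_pow_left₀ 2 (norm_nonneg _) ?_
  have hα2 : ‖α‖ ^ 2 < 1 := pow_lt_one₀ (norm_nonneg _) hα two_ne_zero
  have hz2 : ‖z‖ ^ 2 < 1 := pow_lt_one₀ (norm_nonneg _) hz two_ne_zero
  -- `|1 - ᾱz|² - |z - α|² = (1 - |α|²) (1 - |z|²)`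
  have h : 0 < (1 - ‖α‖ ^ 2) * (1 - ‖z‖ ^ 2) := mul_pos (by linarith) (by linarith)
  simp only [← Complex.normSq_eq_norm_sq, Complex.normSq_apply, Complex.sub_re, Complex.sub_im,
    Complex.mul_re, Complex.mul_im, Complex.conj_re, Complex.conj_im, Complex.one_re,
    Complex.one_im] at h ⊢
  nlinarith

theorem moebius_moebius_neg {α z : ℂ} (hα : ‖α‖ < 1) (hz : ‖z‖ < 1) :
    moebius 0 (-α) (moebius 0 α z) = z := by
  have h2 := one_sub_conj_mul_ne_zero (α := -α) (by simpa using hα)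
    (norm_moebius_lt_one (θ := 0) hα hz)
  have h1 := div_mul_cancel₀ (z - α) (one_sub_conj_mul_ne_zero hα hz)
  simp only [moebius, Complex.ofReal_zero, zero_mul, Complex.exp_zero, one_mul, map_neg, neg_mul,
    sub_neg_eq_add] at h2 ⊢
  rw [div_eq_iff h2]
  linear_combination h1

theorem differentiableOn_moebius {θ : ℝ} {α : ℂ} (hα : ‖α‖ < 1) :
    DifferentiableOn ℂ (moebius θ α) (Metric.ball 0 1) := by
  intro z hz
  have h := one_sub_conj_mul_ne_zero hα (by simpa using hz)
  unfold moebius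
  exact DifferentiableAt.differentiableWithinAt (by fun_prop (disch := exact h))

theorem isDiscAutomorphism_moebius {θ : ℝ} {α : ℂ} (hα : ‖α‖ < 1) :
    IsDiscAutomorphism (moebius θ α) := by
  have hα' : ‖-α‖ < 1 := by simpa using hα
  obtain ⟨c, hc⟩ : ∃ c, c = Complex.exp (θ * Complex.I) := ⟨_, rfl⟩
  have hc1 : ‖c‖ = 1 := by rw [hc, Complex.norm_exp_ofReal_mul_I]
  have hc0 : c ≠ 0 := fun h => by simp [h] at hc1
  have hu : ∀ z : ℂ, ‖c⁻¹ * z‖ = ‖z‖ := fun z => by simp [hc1]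
  have hm : ∀ z, moebius θ α z = c * moebius 0 α z := fun z => by simp [moebius, hc]
  refine ⟨differentiableOn_moebius hα, fun z hz => ?_,
    fun z => moebius 0 (-α) (c⁻¹ * z), ?_, fun z hz => ?_, fun z hz => ?_, fun z hz => ?_⟩
  · simpa using norm_moebius_lt_one hα (by simpa using hz)
  · refine (differentiableOn_moebius hα').comp
      (differentiable_id.const_mul c⁻¹).differentiableOn fun z hz => ?_
    rw [mem_ball_zero_iff] at hz ⊢
    exact (hu z).trans_lt hz
  · rw [mem_ball_zero_iff] at hz ⊢
    exact norm_moebius_lt_one hα' ((hu z).trans_lt hz)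
  · rw [mem_ball_zero_iff] at hz
    change moebius 0 (-α) (c⁻¹ * moebius θ α z) = z
    rw [hm, inv_mul_cancel_left₀ hc0, moebius_moebius_neg hα hz]
  · rw [mem_ball_zero_iff] at hz
    change moebius θ α (moebius 0 (-α) (c⁻¹ * z)) = z
    have h := moebius_moebius_neg hα' ((hu z).trans_lt hz)
    rw [neg_neg] at h
    rw [hm, h, mul_inv_cancel_left₀ hc0]

section Operators

variable {H : Type*} [NormedAddCommGroup H] [InnerProductSpace ℂ H]

theorem moebiusOperator_apply_of_eigenvector [CompleteSpace H] {T : H →L[ℂ] H} {θ : ℝ} {α w : ℂ}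
    {x : H} (hα : ‖α‖ * ‖T‖ < 1) (hw : 1 - conj α * w ≠ 0) (hx : T x = w • x) :
    moebiusOperator θ α T x = moebius θ α w • x := by
  have hu : IsUnit (1 - conj α • T) := isUnit_one_sub_of_norm_lt_one (by simpa [norm_smul] using hα)
  have h1 : (1 - conj α • T) ((1 - conj α * w)⁻¹ • x) = x := by
    rw [map_smul]
    simp only [sub_apply, one_apply_eq_self,
      smul_apply, hx, smul_smul]
    rw [← one_smul ℂ x, smul_smul, ← sub_smul, smul_smul]
    simp [hw]
  have h2 : Ring.inverse (1 - conj α • T) x = (1 - conj α * w)⁻¹ • x := by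
    conv_lhs => rw [← h1]
    rw [← mul_apply_eq_comp, Ring.inverse_mul_cancel _ hu]
    simp
  simp only [moebiusOperator, smul_apply, mul_apply_eq_comp, h2,
    map_smul, sub_apply, one_apply_eq_self, hx, ← sub_smul,
    smul_smul, moebius]
  congr 1
  ring

/-- The unitary implementing a Möbius map `φ` carries eigenvectors at `w` to eigenvectors at
`φ w`. -/
theorem IsHomogeneousOperator.exists_unitary [CompleteSpace H] {T : H →L[ℂ] H}
    (hhom : IsHomogeneousOperator T) (θ : ℝ) {α : ℂ} (hα : ‖α‖ < 1) (hαT : ‖α‖ * ‖T‖ < 1) :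
    ∃ U ∈ unitary (H →L[ℂ] H), T * U = U * moebiusOperator θ α T ∧
      ∀ (w : ℂ) (x : H), ‖w‖ < 1 → T x = w • x → T (U x) = moebius θ α w • U x := by
  obtain ⟨U, hU, h⟩ := hhom.2 _ (isDiscAutomorphism_moebius (θ := θ) hα) θ α hα fun _ _ => rfl
  have h1 : T * U = U * moebiusOperator θ α T := by
    rw [← h, ← mul_assoc, ← mul_assoc, Unitary.mul_star_self_of_mem hU, one_mul]
  refine ⟨U, hU, h1, fun w x hw hx => ?_⟩
  rw [← mul_apply_eq_comp, h1, mul_apply_eq_comp,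
    moebiusOperator_apply_of_eigenvector hαT (one_sub_conj_mul_ne_zero hα hw) hx, map_smul]

theorem moebiusOperator_zero (θ : ℝ) (T : H →L[ℂ] H) :
    moebiusOperator θ 0 T = Complex.exp (θ * Complex.I) • T := by
  simp [moebiusOperator]

/-! ### Eigenvectors of operators in the Cowen-Douglas class -/

theorem mem_ker_sub_smul_one {T : H →L[ℂ] H} {w : ℂ} {x : H} :
    x ∈ LinearMap.ker (T - w • (1 : H →L[ℂ] H)).toLinearMap ↔ T x = w • x := by
  simp [LinearMap.mem_ker, sub_eq_zero]

theorem IsCowenDouglasOne.exists_eigenvector {Ω : Set ℂ} {T : H →L[ℂ] H}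
    (hT : IsCowenDouglasOne Ω T) {w : ℂ} (hw : w ∈ Ω) : ∃ x, ‖x‖ = 1 ∧ T x = w • x := by
  obtain ⟨⟨v, hv⟩, hv0, -⟩ := finrank_eq_one_iff'.mp (hT.finrank_ker w hw)
  rw [mem_ker_sub_smul_one] at hv
  have hv0' : v ≠ 0 := fun h => hv0 (Subtype.ext h)
  refine ⟨(‖v‖⁻¹ : ℂ) • v, ?_, ?_⟩
  · simp [norm_smul, hv0']
  · rw [map_smul, hv, smul_comm]

theorem IsCowenDouglasOne.exists_smul_eq {Ω : Set ℂ} {T : H →L[ℂ] H}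
    (hT : IsCowenDouglasOne Ω T) {w : ℂ} (hw : w ∈ Ω) {x y : H} (hx : T x = w • x) (hx0 : x ≠ 0)
    (hy : T y = w • y) : ∃ c : ℂ, c • x = y := by
  obtain ⟨c, hc⟩ := (finrank_eq_one_iff_of_nonzero'
    (⟨x, mem_ker_sub_smul_one.mpr hx⟩ : LinearMap.ker (T - w • (1 : H →L[ℂ] H)).toLinearMap)
    (fun h => hx0 (congrArg Subtype.val h))).mp (hT.finrank_ker w hw)
    ⟨y, mem_ker_sub_smul_one.mpr hy⟩
  exact ⟨c, congrArg Subtype.val hc⟩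

/-- The eigenvectors at `w ≠ 0` lie in the range of `T`, and as `w → 0` they approach the kernel
of `T`; as the range is closed, it contains the kernel as well, hence all eigenvectors. -/
theorem IsCowenDouglasOne.surjective [CompleteSpace H] {T : H →L[ℂ] H}
    (hT : IsCowenDouglasOne (Metric.ball (0 : ℂ) 1) T) : Function.Surjective T := by
  have h0 : (0 : ℂ) ∈ Metric.ball (0 : ℂ) 1 := by simp
  obtain ⟨e, he1, he⟩ := hT.exists_eigenvector h0
  have he0 : e ≠ 0 := fun h => by simp [h] at he1
  have hcl : IsClosed (T.range : Set H) := by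
    have h := hT.isClosed_range 0 h0
    rw [zero_smul, sub_zero] at h
    exact h
  have : CompleteSpace T.range := hcl.completeSpace_coe
  obtain ⟨C, hC0, hC⟩ := (T.rangeRestrict).exists_preimage_norm_le
    (LinearMap.surjective_rangeRestrict T.toLinearMap)
  have hmem : ∀ {w : ℂ} {x : H}, w ≠ 0 → T x = w • x → x ∈ T.range := fun {w x} hw hx =>
    ⟨w⁻¹ • x, by simp [hx, hw]⟩
  have hker : e ∈ T.range := by
    rw [← SetLike.mem_coe, ← hcl.closure_eq, Metric.mem_closure_iff]
    intro ε hε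
    -- a positive real `w` with `C w ≤ 1 / 2` and `2 C w < ε`
    obtain ⟨w, hw0, hw⟩ := exists_between (show 0 < min 1 (min (1 / (2 * C)) (ε / (2 * C))) by
      positivity)
    simp only [lt_min_iff] at hw
    have hCw : C * w < 1 / 2 := by
      have := hw.2.1
      rw [lt_div_iff₀ (by positivity)] at this
      linarith
    have hCε : 2 * (C * w) < ε := by
      have := hw.2.2
      rw [lt_div_iff₀ (by positivity)] at this
      linarith
    have hwc : (w : ℂ) ≠ 0 := by exact_mod_cast hw0.ne'
    obtain ⟨x, hx1, hx⟩ := hT.exists_eigenvector (w := (w : ℂ))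
      (by simpa [abs_of_pos hw0] using hw.1)
    obtain ⟨u, hu, hun⟩ := hC ⟨T x, x, rfl⟩
    have hu' : T u = T x := congrArg Subtype.val hu
    have hun' : ‖u‖ ≤ C * w := by
      refine hun.trans_eq ?_
      have h : ‖T x‖ = w := by
        rw [hx, norm_smul, hx1]
        simp [abs_of_pos hw0]
      exact congrArg (C * ·) h
    obtain ⟨c, hc⟩ := hT.exists_smul_eq h0 he he0 (y := x - u) (by simp [hu'])
    have hcn : 1 / 2 ≤ ‖c‖ := by
      have h1 : ‖c‖ = ‖x - u‖ := by rw [← hc, norm_smul, he1, mul_one]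
      have h2 := norm_sub_norm_le x u
      linarith
    have hc0 : c ≠ 0 := fun h => by norm_num [h] at hcn
    refine ⟨c⁻¹ • x, T.range.smul_mem _ (hmem hwc hx), ?_⟩
    have h3 : e - c⁻¹ • x = -(c⁻¹ • u) := by
      rw [← inv_smul_smul₀ hc0 e, hc, smul_sub]
      abel
    rw [dist_eq_norm, h3, norm_neg, norm_smul, norm_inv]
    have h4 : ‖c‖⁻¹ ≤ 2 := by
      rw [inv_le_comm₀ (by linarith) two_pos]
      linarith
    calc ‖c‖⁻¹ * ‖u‖ ≤ 2 * (C * w) := by gcongr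
      _ < ε := hCε
  have hle : (⨆ w ∈ Metric.ball (0 : ℂ) 1,
      LinearMap.ker (T - w • (1 : H →L[ℂ] H)).toLinearMap : Submodule ℂ H) ≤ T.range := by
    refine iSup₂_le fun w hw x hx => ?_
    rw [mem_ker_sub_smul_one] at hx
    rcases eq_or_ne w 0 with rfl | hw0
    · obtain ⟨c, rfl⟩ := hT.exists_smul_eq h0 he he0 hx
      exact T.range.smul_mem _ hker
    · exact hmem hw0 hx
  intro y
  have hy := (hT.dense_span.mono (SetLike.coe_subset_coe.mpr hle)) y
  rwa [hcl.closure_eq] at hy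

/-- A surjective bounded operator on a Hilbert space has a bounded right inverse with values in the
orthogonal complement of the kernel. -/
theorem exists_rightInverse_of_surjective [CompleteSpace H] {T : H →L[ℂ] H}
    (hT : Function.Surjective T) :
    ∃ S : H →L[ℂ] H, (∀ x, T (S x) = x) ∧ ∀ x k, T k = 0 → ⟪k, S x⟫_ℂ = 0 := by
  have : CompleteSpace (T.ker : Submodule ℂ H) := T.isClosed_ker.completeSpace_coe
  let R : T.kerᗮ →L[ℂ] H := T ∘L T.kerᗮ.subtypeL
  have hinj : R.ker = ⊥ := by
    rw [Submodule.eq_bot_iff]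
    rintro ⟨x, hx⟩ hRx
    have hx0 : x ∈ T.ker := hRx
    exact Subtype.ext (inner_self_eq_zero.mp (Submodule.inner_right_of_mem_orthogonal hx0 hx))
  have hsurj : R.range = ⊤ := by
    rw [Submodule.eq_top_iff']
    intro y
    obtain ⟨x, rfl⟩ := hT y
    obtain ⟨k, hk, z, hz, rfl⟩ := T.ker.exists_add_mem_mem_orthogonal x
    refine ⟨⟨z, hz⟩, ?_⟩
    have hk0 : T k = 0 := hk
    simp [R, hk0]
  let E := ContinuousLinearEquiv.ofBijective R hinj hsurj
  refine ⟨T.kerᗮ.subtypeL ∘L (E.symm : H →L[ℂ] T.kerᗮ), fun x => ?_, fun x k hk => ?_⟩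
  · exact ContinuousLinearEquiv.ofBijective_apply_symm_apply R hinj hsurj x
  · exact Submodule.inner_right_of_mem_orthogonal (K := T.ker) hk (E.symm x).2

/-! ### The orthogonal sequence shifted by a homogeneous operator -/

/-- The sequence `v` is orthogonal, starts with a unit vector killed by `T`, and is shifted
backwards by `T`. The other vectors are not normalized. -/
structure IsBackwardShiftOn (T : H →L[ℂ] H) (v : ℕ → H) : Prop where
  norm_zero : ‖v 0‖ = 1
  map_zero : T (v 0) = 0
  map_succ : ∀ n, T (v (n + 1)) = v n
  inner_eq_zero : ∀ m n, m ≠ n → ⟪v m, v n⟫_ℂ = 0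

/-- The sequence is `v n = S ^ n e` with `e` a unit vector in the kernel and `S` the right inverse
of `T` with values orthogonal to the kernel. The unitaries that implement the rotations act on it by
distinct characters of the circle, so it is orthogonal. -/
theorem IsHomogeneousOperator.exists_isBackwardShiftOn [CompleteSpace H] {T : H →L[ℂ] H}
    (hT : IsCowenDouglasOne (Metric.ball (0 : ℂ) 1) T) (hhom : IsHomogeneousOperator T) :
    ∃ (v : ℕ → H) (C : ℝ), IsBackwardShiftOn T v ∧ 0 ≤ C ∧ ∀ n, ‖v n‖ ≤ C ^ n := by
  have h0 : (0 : ℂ) ∈ Metric.ball (0 : ℂ) 1 := by simp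
  obtain ⟨e, he1, he⟩ := hT.exists_eigenvector h0
  have he0 : e ≠ 0 := fun h => by simp [h] at he1
  obtain ⟨S, hTS, hS⟩ := exists_rightInverse_of_surjective hT.surjective
  let v : ℕ → H := fun n => (S ^ n) e
  have hv0 : v 0 = e := by simp [v]
  have hvs : ∀ n, v (n + 1) = S (v n) := fun n =>
    congrArg (fun A : H →L[ℂ] H => A e) (pow_succ' S n)
  have hTv : ∀ n, T (v (n + 1)) = v n := fun n => by rw [hvs, hTS]
  have hTe : T e = 0 := by rw [he, zero_smul]
  have hker : ∀ n, ⟪e, v (n + 1)⟫_ℂ = 0 := fun n => by rw [hvs]; exact hS _ _ hTe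
  have hrot : ∀ θ : ℝ, ∃ U ∈ unitary (H →L[ℂ] H), ∃ d : ℂ, ‖d‖ = 1 ∧
      ∀ n, U (v n) = (d * Complex.exp (θ * Complex.I) ^ n) • v n := by
    intro θ
    obtain ⟨U, hU, hTU, -⟩ := hhom.exists_unitary θ (α := 0) (by simp) (by simp)
    have hTU' : ∀ x, T (U x) = Complex.exp (θ * Complex.I) • U (T x) := fun x => by
      have h := congrArg (fun A : H →L[ℂ] H => A x) hTU
      simpa [moebiusOperator_zero, mul_apply_eq_comp] using h
    obtain ⟨d, hd⟩ := hT.exists_smul_eq h0 he he0 (y := U e) (by simp [hTU', hTe])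
    have hd1 : ‖d‖ = 1 := by
      have h := congrArg norm hd
      rw [norm_smul, he1, mul_one] at h
      rw [h, ContinuousLinearMap.norm_map_of_mem_unitary hU, he1]
    have hd0 : d ≠ 0 := fun h => by simp [h] at hd1
    refine ⟨U, hU, d, hd1, fun n => ?_⟩
    induction n with
    | zero => simp [hv0, hd]
    | succ n ih =>
      -- both sides have the same image under `T` and are orthogonal to its kernel
      obtain ⟨k, hk⟩ := hT.exists_smul_eq h0 he he0
        (y := U (v (n + 1)) - (d * Complex.exp (θ * Complex.I) ^ (n + 1)) • v (n + 1)) (by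
          rw [zero_smul, map_sub, hTU', hTv, ih, map_smul, hTv, smul_smul, sub_eq_zero]
          congr 1
          ring)
      have h1 : ⟪e, U (v (n + 1))⟫_ℂ = 0 := by
        have h := ContinuousLinearMap.inner_map_map_of_mem_unitary hU e (v (n + 1))
        rw [← hd, inner_smul_left, hker] at h
        simpa [hd0] using h
      have h2 := congrArg (fun y => ⟪e, y⟫_ℂ) hk
      simp only [inner_sub_right, inner_smul_right, h1, hker, mul_zero, sub_zero,
        inner_self_eq_norm_sq_to_K, he1] at h2
      have hk0 : k = 0 := by simpa using h2
      rw [hk0, zero_smul] at hk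
      exact sub_eq_zero.mp hk.symm
  refine ⟨v, ‖S‖, ⟨by rw [hv0, he1], by rw [hv0, hTe], hTv, fun m n hmn => ?_⟩, norm_nonneg _,
    fun n => ?_⟩
  · -- the rotation by `π / (n - m)` acts on `⟪v m, v n⟫` as multiplication by `-1`
    have hnm : (n : ℂ) - m ≠ 0 := sub_ne_zero.mpr (by exact_mod_cast hmn.symm)
    obtain ⟨U, hU, d, hd1, h⟩ := hrot (Real.pi / (n - m))
    have h1 := ContinuousLinearMap.inner_map_map_of_mem_unitary hU (v m) (v n)
    have hdd : conj d * d = 1 := by rw [Complex.conj_mul', hd1]; simp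
    have hexp : conj (Complex.exp ((Real.pi / (n - m) : ℝ) * Complex.I) ^ m) *
        Complex.exp ((Real.pi / (n - m) : ℝ) * Complex.I) ^ n = -1 := by
      rw [map_pow, ← Complex.exp_conj, ← Complex.exp_nat_mul, ← Complex.exp_nat_mul,
        ← Complex.exp_add, ← Complex.exp_pi_mul_I]
      congr 1
      simp only [map_mul, Complex.conj_ofReal, Complex.conj_I]
      push_cast
      field_simp
      ring
    rw [h, h, inner_smul_left, inner_smul_right, map_mul] at h1
    have h2 : -⟪v m, v n⟫_ℂ = ⟪v m, v n⟫_ℂ := by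
      linear_combination h1 - ⟪v m, v n⟫_ℂ * hexp - ⟪v m, v n⟫_ℂ *
        (conj (Complex.exp ((Real.pi / (n - m) : ℝ) * Complex.I) ^ m) *
        Complex.exp ((Real.pi / (n - m) : ℝ) * Complex.I) ^ n) * hdd
    exact neg_eq_self.mp h2
  · induction n with
    | zero => simp [hv0, he1]
    | succ n ih =>
      rw [hvs, pow_succ']
      exact (S.le_opNorm _).trans (mul_le_mul_of_nonneg_left ih (norm_nonneg _))

theorem hasSum_zero_pow_smul (v : ℕ → H) : HasSum (fun n => (0 : ℂ) ^ n • v n) (v 0) := by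
  convert hasSum_single (f := fun n => (0 : ℂ) ^ n • v n) 0 fun n hn => by simp [hn] using 1
  simp

namespace IsBackwardShiftOn

variable {T : H →L[ℂ] H} {v : ℕ → H}

theorem ne_zero (hv : IsBackwardShiftOn T v) (n : ℕ) : v n ≠ 0 := by
  induction n with
  | zero => exact fun h => by simpa [h] using hv.norm_zero
  | succ n ih => exact fun h => ih (by rw [← hv.map_succ, h]; exact T.map_zero)

theorem hasSum_inner (hv : IsBackwardShiftOn T v) {w z : ℂ} {x y : H}
    (hx : HasSum (fun n => w ^ n • v n) x) (hy : HasSum (fun n => z ^ n • v n) y) :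
    HasSum (fun n => ((‖v n‖ ^ 2 : ℝ) : ℂ) * (conj w * z) ^ n) ⟪x, y⟫_ℂ := by
  have h1 : ∀ n, ⟪v n, x⟫_ℂ = w ^ n * (‖v n‖ ^ 2 : ℝ) := fun n => by
    refine ((innerSL ℂ (v n)).hasSum hx).unique ?_
    have e : w ^ n * ((‖v n‖ ^ 2 : ℝ) : ℂ) = innerSL ℂ (v n) (w ^ n • v n) := by
      rw [innerSL_apply_apply, inner_smul_right, inner_self_eq_norm_sq_to_K]
      norm_cast
    rw [e]
    exact hasSum_single (f := fun m => innerSL ℂ (v n) (w ^ m • v m)) n fun m hm => by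
      simp [hv.inner_eq_zero n m hm.symm]
  refine (congrArg (HasSum · _) (funext fun n => ?_)).mp ((innerSL ℂ x).hasSum hy)
  rw [innerSL_apply_apply, inner_smul_right, ← inner_conj_symm, h1, mul_pow,
    map_mul, map_pow, Complex.conj_ofReal]
  ring

theorem map_eq_smul_of_hasSum (hv : IsBackwardShiftOn T v) {w : ℂ} {x : H}
    (hx : HasSum (fun n => w ^ n • v n) x) : T x = w • x := by
  have h1 := (hasSum_nat_add_iff' 1).mpr (T.hasSum hx)
  simp only [map_smul, hv.map_succ, Finset.range_one, Finset.sum_singleton,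
    hv.map_zero, smul_zero, sub_zero, pow_succ', mul_smul] at h1
  exact h1.unique (hx.const_smul w)

theorem inner_zero_eq_one (hv : IsBackwardShiftOn T v) {w : ℂ} {x : H}
    (hx : HasSum (fun n => w ^ n • v n) x) : ⟪v 0, x⟫_ℂ = 1 := by
  refine (hv.hasSum_inner (hasSum_zero_pow_smul v) hx).unique ?_
  convert hasSum_single (f := fun n => ((‖v n‖ ^ 2 : ℝ) : ℂ) * (conj 0 * w) ^ n) 0
    fun n hn => by simp [hn] using 1
  simp [hv.norm_zero]

theorem ne_zero_of_hasSum (hv : IsBackwardShiftOn T v) {w : ℂ} {x : H}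
    (hx : HasSum (fun n => w ^ n • v n) x) : x ≠ 0 := fun h => by
  simpa [h] using hv.inner_zero_eq_one hx

/-- Orthogonality gives convergence of the eigenvector series wherever the series of squared norms
converges. -/
theorem summable [CompleteSpace H] (hv : IsBackwardShiftOn T v) {w : ℂ}
    (h : Summable fun n => ‖v n‖ ^ 2 * (‖w‖ ^ 2) ^ n) : Summable fun n => w ^ n • v n := by
  have hnorm : ∀ n, (‖v n‖ : ℂ) ≠ 0 := fun n => by simpa using hv.ne_zero n
  have ho : Orthonormal ℂ fun n => (‖v n‖⁻¹ : ℂ) • v n := by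
    refine ⟨fun n => ?_, fun m n hmn => ?_⟩
    · simpa [norm_smul] using inv_mul_cancel₀ (norm_ne_zero_iff.mpr (hv.ne_zero n))
    · simp [inner_smul_left, inner_smul_right, hv.inner_eq_zero m n hmn]
  have h1 := (ho.orthogonalFamily.summable_iff_norm_sq_summable
    (fun n => w ^ n * (‖v n‖ : ℂ))).mpr (by
      refine h.congr fun n => ?_
      simp [mul_pow, mul_comm, ← pow_mul])
  refine h1.congr fun n => ?_
  simp [smul_smul, hnorm n]

end IsBackwardShiftOn

/-! ### The squared norms of the shifted sequence -/

/-- A unitary implementing a real Möbius map moves the eigenlines at `0` and `s` to those at `t` and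
`(s + t) / (1 + s t)`, so both pairs enclose the same angle. -/
theorem IsHomogeneousOperator.inner_sq_eq [CompleteSpace H] {T : H →L[ℂ] H} {v : ℕ → H}
    (hT : IsCowenDouglasOne (Metric.ball (0 : ℂ) 1) T) (hhom : IsHomogeneousOperator T)
    (hv : IsBackwardShiftOn T v) {s t u : ℝ} (hs : |s| < 1) (ht : |t| < 1) (htT : |t| * ‖T‖ < 1)
    (hu : u = (s + t) / (1 + s * t)) {xs xt xu : H}
    (hxs : HasSum (fun n => (s : ℂ) ^ n • v n) xs) (hxt : HasSum (fun n => (t : ℂ) ^ n • v n) xt)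
    (hxu : HasSum (fun n => (u : ℂ) ^ n • v n) xu) :
    ‖⟪xt, xu⟫_ℂ‖ ^ 2 * ‖xs‖ ^ 2 = ‖xt‖ ^ 2 * ‖xu‖ ^ 2 := by
  obtain ⟨U, hU, -, h⟩ := hhom.exists_unitary 0 (α := ((-t : ℝ) : ℂ)) (by simpa using ht)
    (by simpa using htT)
  have hm : ∀ z : ℝ, moebius 0 ((-t : ℝ) : ℂ) z = (((z + t) / (1 + z * t) : ℝ) : ℂ) := fun z => by
    simp only [moebius, Complex.conj_ofReal]
    push_cast
    simp [mul_comm]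
  have h0 := h 0 (v 0) (by simp) (by rw [hv.map_zero, zero_smul])
  have h1 := h s xs (by simpa using hs) (hv.map_eq_smul_of_hasSum hxs)
  have hm0 := hm 0
  rw [zero_add, zero_mul, add_zero, div_one, Complex.ofReal_zero] at hm0
  rw [hm0] at h0
  rw [hm, ← hu] at h1
  have hu1 : ‖(u : ℂ)‖ < 1 := by
    rw [hu, ← hm]
    exact norm_moebius_lt_one (by simpa using ht) (by simpa using hs)
  obtain ⟨c, hc⟩ := hT.exists_smul_eq (by simpa using ht) (hv.map_eq_smul_of_hasSum hxt)
    (hv.ne_zero_of_hasSum hxt) h0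
  obtain ⟨d, hd⟩ := hT.exists_smul_eq (by simpa using hu1) (hv.map_eq_smul_of_hasSum hxu)
    (hv.ne_zero_of_hasSum hxu) h1
  have hcn : ‖c‖ * ‖xt‖ = 1 := by
    rw [← norm_smul, hc, ContinuousLinearMap.norm_map_of_mem_unitary hU, hv.norm_zero]
  have hdn : ‖d‖ * ‖xu‖ = ‖xs‖ := by
    rw [← norm_smul, hd, ContinuousLinearMap.norm_map_of_mem_unitary hU]
  have hcd : ‖c‖ * (‖d‖ * ‖⟪xt, xu⟫_ℂ‖) = 1 := by
    have h2 := ContinuousLinearMap.inner_map_map_of_mem_unitary hU (v 0) xs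
    rw [hv.inner_zero_eq_one hxs, ← hc, ← hd, inner_smul_left, inner_smul_right] at h2
    simpa using congrArg norm h2
  calc ‖⟪xt, xu⟫_ℂ‖ ^ 2 * ‖xs‖ ^ 2
      = ‖⟪xt, xu⟫_ℂ‖ ^ 2 * (‖d‖ * ‖xu‖) ^ 2 * (‖c‖ * ‖xt‖) ^ 2 := by rw [hcn, hdn]; ring
    _ = (‖c‖ * (‖d‖ * ‖⟪xt, xu⟫_ℂ‖)) ^ 2 * (‖xt‖ ^ 2 * ‖xu‖ ^ 2) := by ring
    _ = ‖xt‖ ^ 2 * ‖xu‖ ^ 2 := by rw [hcd]; ring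

/-- The squared norms `‖v n‖²` are the coefficients of `(1 - x) ^ (-2l)`, where `2l = ‖v 1‖²`. -/
theorem IsHomogeneousOperator.hasSum_norm_sq [CompleteSpace H] {T : H →L[ℂ] H} {v : ℕ → H} {C : ℝ}
    (hT : IsCowenDouglasOne (Metric.ball (0 : ℂ) 1) T) (hhom : IsHomogeneousOperator T)
    (hv : IsBackwardShiftOn T v) (hC0 : 0 ≤ C) (hC : ∀ n, ‖v n‖ ≤ C ^ n) {l : ℝ}
    (hl : 2 * l = ‖v 1‖ ^ 2) {x : ℂ} (hx : ‖x‖ < 1) :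
    HasSum (fun n => ((‖v n‖ ^ 2 : ℝ) : ℂ) * x ^ n) ((1 - x) ^ (-(2 * l) : ℂ)) := by
  have hl0 : 0 < l := by
    have : 0 < ‖v 1‖ ^ 2 := pow_pos (norm_pos_iff.mpr (hv.ne_zero 1)) 2
    linarith
  -- for `|s|, |t| < r` the eigenvector series converge and `1 - t T` is invertible
  let r : ℝ := 1 / (1 + C + ‖T‖)
  have hD : 0 < 1 + C + ‖T‖ := by positivity
  have hr0 : 0 < r := by positivity
  have hrD : r * (1 + C + ‖T‖) = 1 := by simp only [r]; field_simp
  have hrC : 0 ≤ r * C := by positivity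
  have hrT : 0 ≤ r * ‖T‖ := by positivity
  have hr1 : r ≤ 1 := by linarith
  have hCr : C * r < 1 := by linarith
  have hTr : r * ‖T‖ < 1 := by linarith
  have hsumv : ∀ s : ℝ, |s| < r → Summable fun n => (s : ℂ) ^ n • v n := fun s hs => by
    have h1 : C * |s| < 1 := (mul_le_mul_of_nonneg_left hs.le hC0).trans_lt hCr
    refine Summable.of_norm_bounded (summable_geometric_of_lt_one (by positivity) h1) fun n => ?_
    rw [norm_smul, norm_pow, Complex.norm_real, Real.norm_eq_abs, mul_pow, mul_comm]
    gcongr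
    exact hC n
  let f : ℝ → ℝ := fun x => ∑' n, ‖v n‖ ^ 2 * x ^ n
  have hf : ∀ x, |x| < r ^ 2 → HasSum (fun n => ‖v n‖ ^ 2 * x ^ n) (f x) := fun x hx => by
    have h1 : C ^ 2 * |x| < 1 := by
      refine (mul_le_mul_of_nonneg_left hx.le (by positivity)).trans_lt ?_
      rw [← mul_pow]
      exact pow_lt_one₀ (by positivity) hCr two_ne_zero
    refine (Summable.of_norm_bounded (summable_geometric_of_lt_one (by positivity) h1)
      fun n => ?_).hasSum
    rw [norm_mul, norm_pow, norm_pow, norm_norm, Real.norm_eq_abs, mul_pow, ← pow_mul, mul_comm 2,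
      pow_mul]
    gcongr
    exact hC n
  have hinner : ∀ {s t : ℝ} {x y : H}, |s| < r → |t| < r →
      HasSum (fun n => (s : ℂ) ^ n • v n) x → HasSum (fun n => (t : ℂ) ^ n • v n) y →
      ⟪x, y⟫_ℂ = f (s * t) := fun {s t x y} hs ht hx hy => by
    have hst : |s * t| < r ^ 2 := by
      rw [abs_mul, sq]
      exact mul_lt_mul'' hs ht (abs_nonneg _) (abs_nonneg _)
    refine (hv.hasSum_inner hx hy).unique ?_
    rw [Complex.conj_ofReal]
    exact_mod_cast Complex.hasSum_ofReal.mpr (hf _ hst)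
  have hnorm : ∀ {s : ℝ} {x : H}, |s| < r → HasSum (fun n => (s : ℂ) ^ n • v n) x →
      ‖x‖ ^ 2 = f (s ^ 2) := fun {s x} hs hx => by
    have h := hinner hs hs hx hx
    rw [inner_self_eq_norm_sq_to_K, ← sq] at h
    exact Complex.ofReal_injective ((Complex.ofReal_pow _ _).trans h)
  have hbin := eq_one_sub_rpow_of_moebius_invariant (a := fun n => ‖v n‖ ^ 2) hr0 hr1
    (by simp [hv.norm_zero]) hf fun s t hs ht hu => by
      have hxs := (hsumv s hs).hasSum
      have hxt := (hsumv t ht).hasSum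
      have hxu := (hsumv _ hu).hasSum
      have h := hhom.inner_sq_eq hT hv (hs.trans_le hr1) (ht.trans_le hr1)
        ((mul_le_mul_of_nonneg_right ht.le (norm_nonneg _)).trans_lt hTr) rfl hxs hxt hxu
      rw [hinner ht hu hxt hxu, hnorm hs hxs, hnorm ht hxt, hnorm hu hxu, Complex.norm_real,
        Real.norm_eq_abs, sq_abs] at h
      exact h
  obtain ⟨b, -, hb⟩ := hasSum_discKernel hl0
  have hr2 : r ^ 2 ≤ 1 := pow_le_one₀ hr0.le hr1
  have hbr : ∀ y : ℝ, |y| < r ^ 2 → HasSum (fun n => b n * y ^ n) ((1 - y) ^ (-(2 * l))) :=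
    fun y hy => by
      have hy1 : |y| < 1 := hy.trans_le hr2
      have h := hb y (by simpa using hy1)
      have e : (1 - (y : ℂ)) ^ (-(2 * l) : ℂ) = (((1 - y) ^ (-(2 * l)) : ℝ) : ℂ) := by
        rw [Complex.ofReal_cpow (by linarith [(abs_lt.mp hy1).2])]
        push_cast
        rfl
      rw [e] at h
      exact_mod_cast h
  have hab : (fun n => ‖v n‖ ^ 2) = b :=
    eq_of_hasSum_of_eqOn (pow_pos hr0 2) hf hbr fun y hy => by
      rw [hl]
      exact hbin y ⟨hy.1.le, hy.2⟩
  subst hab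
  exact hb x hx

end Operators

/-! ### Comparison with the reproducing kernel Hilbert space -/

/-- Families with dense span and equal Gram matrices correspond under a unitary. -/
theorem exists_linearIsometryEquiv_of_inner_eq {X E F : Type*} [NormedAddCommGroup E]
    [InnerProductSpace ℂ E] [CompleteSpace E] [NormedAddCommGroup F] [InnerProductSpace ℂ F]
    [CompleteSpace F] {g : X → E} {k : X → F}
    (hg : Dense (Submodule.span ℂ (Set.range g) : Set E))
    (hk : Dense (Submodule.span ℂ (Set.range k) : Set F))
    (hgk : ∀ x y, ⟪g x, g y⟫_ℂ = ⟪k x, k y⟫_ℂ) : ∃ V : E ≃ₗᵢ[ℂ] F, ∀ x, V (g x) = k x := by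
  have hg' : DenseRange (Finsupp.linearCombination ℂ g) := by
    rwa [DenseRange, ← LinearMap.coe_range, Finsupp.range_linearCombination]
  have hk' : DenseRange (Finsupp.linearCombination ℂ k) := by
    rwa [DenseRange, ← LinearMap.coe_range, Finsupp.range_linearCombination]
  have hn : ∀ c, ‖Finsupp.linearCombination ℂ k (LinearEquiv.refl ℂ (X →₀ ℂ) c)‖ =
      ‖Finsupp.linearCombination ℂ g c‖ := fun c => by
    have h : ⟪Finsupp.linearCombination ℂ k c, Finsupp.linearCombination ℂ k c⟫_ℂ =
        ⟪Finsupp.linearCombination ℂ g c, Finsupp.linearCombination ℂ g c⟫_ℂ := by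
      simp only [Finsupp.linearCombination_apply, Finsupp.sum_inner, Finsupp.inner_sum,
        inner_smul_left, inner_smul_right, hgk]
    rw [inner_self_eq_norm_sq_to_K, inner_self_eq_norm_sq_to_K] at h
    exact (sq_eq_sq₀ (norm_nonneg _) (norm_nonneg _)).mp (by exact_mod_cast h)
  refine ⟨(LinearEquiv.refl ℂ (X →₀ ℂ)).extendOfIsometry _ _ hg' hk' hn, fun x => ?_⟩
  simpa using LinearEquiv.extendOfIsometry_eq (LinearEquiv.refl ℂ (X →₀ ℂ)) _ _ hg' hk' hn
    (Finsupp.single x 1)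

theorem dense_span_kerFun (l : Set.Ioi (0 : ℝ)) :
    Dense (Submodule.span ℂ (Set.range fun z : 𝔻 => RKHS.kerFun (DiscRKHS l) z (1 : ℂ)) :
      Set (DiscRKHS l)) := by
  rw [Submodule.dense_iff_topologicalClosure_eq_top, eq_top_iff,
    ← RKHS.kerFun_dense (DiscRKHS l)]
  refine Submodule.topologicalClosure_mono (Submodule.span_le.mpr ?_)
  rintro _ ⟨z, c, rfl⟩
  have h : RKHS.kerFun (DiscRKHS l) z c = c • RKHS.kerFun (DiscRKHS l) z (1 : ℂ) := by
    rw [← map_smul, smul_eq_mul, mul_one]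
  rw [h]
  exact Submodule.smul_mem _ _ (Submodule.subset_span ⟨z, rfl⟩)

theorem inner_kerFun_kerFun (l : Set.Ioi (0 : ℝ)) (z w : 𝔻) :
    ⟪RKHS.kerFun (DiscRKHS l) z (1 : ℂ), RKHS.kerFun (DiscRKHS l) w (1 : ℂ)⟫_ℂ =
      (1 - (z : ℂ) * conj (w : ℂ)) ^ (-(2 * (l : ℝ)) : ℂ) := by
  rw [RKHS.kerFun_inner, RKHS.kerFun_apply, RKHS.OfKernel.kernel_ofKernel, discKernel_apply]
  simp

/-- An operator whose eigenvectors at the points `w` have the kernel functions at `w̄` as images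
under a unitary is the adjoint of multiplication by the coordinate. -/
theorem exists_isMultiplicationByZ_of_eigenvectors {H : Type*} [NormedAddCommGroup H]
    [InnerProductSpace ℂ H] [CompleteSpace H] {T : H →L[ℂ] H}
    {l : Set.Ioi (0 : ℝ)} {g : 𝔻 → H} (V : H ≃ₗᵢ[ℂ] DiscRKHS l)
    (hV : ∀ z, V (g z) = RKHS.kerFun (DiscRKHS l) z (1 : ℂ))
    (hg : ∀ z, T (g z) = conj (z : ℂ) • g z) :
    ∃ M : DiscRKHS l →L[ℂ] DiscRKHS l,
      IsMultiplicationByZ M ∧ UnitarilyEquivalent T (ContinuousLinearMap.adjoint M) := by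
  let A : DiscRKHS l →L[ℂ] DiscRKHS l :=
    (V : H →L[ℂ] DiscRKHS l) ∘L T ∘L (V.symm : DiscRKHS l →L[ℂ] H)
  have hA : ∀ x, A (V x) = V (T x) := fun x => by simp [A]
  refine ⟨ContinuousLinearMap.adjoint A, fun f z => ?_, V, fun x => ?_⟩
  · have h : ∀ f : DiscRKHS l, f z = ⟪RKHS.kerFun (DiscRKHS l) z (1 : ℂ), f⟫_ℂ := fun f => by
      rw [RKHS.kerFun_inner]
      simp
    rw [h, ContinuousLinearMap.adjoint_inner_right, ← hV, hA, hg, map_smul, inner_smul_left,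
      Complex.conj_conj, hV, ← h]
  · rw [ContinuousLinearMap.adjoint_adjoint, hA]

theorem mainTheorem3 {H : Type*} [NormedAddCommGroup H] [InnerProductSpace ℂ H] [CompleteSpace H]
    (T : H →L[ℂ] H) (hT : IsCowenDouglasOne (Metric.ball (0 : ℂ) 1) T)
    (hhom : IsHomogeneousOperator T) :
    ∃ (l : Set.Ioi (0 : ℝ)) (M : DiscRKHS l →L[ℂ] DiscRKHS l),
      IsMultiplicationByZ M ∧ UnitarilyEquivalent T (ContinuousLinearMap.adjoint M) := by
  obtain ⟨v, C, hv, hC0, hC⟩ := hhom.exists_isBackwardShiftOn hT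
  have hl : 0 < ‖v 1‖ ^ 2 / 2 := by
    have := pow_pos (norm_pos_iff.mpr (hv.ne_zero 1)) 2
    positivity
  let l : Set.Ioi (0 : ℝ) := ⟨‖v 1‖ ^ 2 / 2, hl⟩
  have hsum : ∀ {x : ℂ}, ‖x‖ < 1 → HasSum (fun n => ((‖v n‖ ^ 2 : ℝ) : ℂ) * x ^ n)
      ((1 - x) ^ (-(2 * (l : ℝ)) : ℂ)) := fun hx =>
    hhom.hasSum_norm_sq hT hv hC0 hC (mul_div_cancel₀ _ two_ne_zero) hx
  have hsumm : ∀ w : ℂ, ‖w‖ < 1 → Summable fun n => w ^ n • v n := fun w hw => by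
    refine hv.summable ?_
    have h := (hsum (x := ((‖w‖ ^ 2 : ℝ) : ℂ)) (by
      simpa using pow_lt_one₀ (norm_nonneg w) hw two_ne_zero)).summable
    exact_mod_cast h
  let g : 𝔻 → H := fun z => ∑' n, conj (z : ℂ) ^ n • v n
  have hz : ∀ z : 𝔻, ‖conj (z : ℂ)‖ < 1 := fun z => by simpa using z.norm_lt_one
  have hgs : ∀ z : 𝔻, HasSum (fun n => conj (z : ℂ) ^ n • v n) (g z) := fun z =>
    (hsumm _ (hz z)).hasSum
  have hTg : ∀ z : 𝔻, T (g z) = conj (z : ℂ) • g z := fun z => hv.map_eq_smul_of_hasSum (hgs z)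
  have hdense : Dense (Submodule.span ℂ (Set.range g) : Set H) := by
    refine hT.dense_span.mono (SetLike.coe_subset_coe.mpr (iSup₂_le fun w hw x hx => ?_))
    rw [mem_ker_sub_smul_one] at hx
    have hw1 : ‖conj w‖ < 1 := by simpa using hw
    have hTw := hTg (Complex.UnitDisc.mk (conj w) hw1)
    rw [Complex.UnitDisc.coe_mk, Complex.conj_conj] at hTw
    obtain ⟨c, rfl⟩ := hT.exists_smul_eq hw hTw (hv.ne_zero_of_hasSum (hgs _)) hx
    exact Submodule.smul_mem _ _ (Submodule.subset_span ⟨_, rfl⟩)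
  obtain ⟨V, hV⟩ := exists_linearIsometryEquiv_of_inner_eq hdense (dense_span_kerFun l)
    fun z w => by
      rw [inner_kerFun_kerFun]
      have h := hv.hasSum_inner (hgs z) (hgs w)
      rw [Complex.conj_conj] at h
      exact h.unique (hsum (norm_coe_mul_conj_lt_one z w))
  exact ⟨l, exists_isMultiplicationByZ_of_eigenvectors V hV hTg⟩
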